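/- Let $(\mathsf Z,\mathscr Z)$ be a measurable space, $P$ a stochastic kernel on it, $\alpha\in[0,1]$, $\beta\in(0,1)$, and let $s,c\colon\mathsf Z\to\mathbb R$ be measurable. Write $Ph(z)=\int h(z')\,P(z,dz')$, let $P^t$ be the $t$-step kernel ($P^0(z,\cdot)=\delta_z$), and let $(Z_t)_{t\ge 0}$ be the Markov process with kernel $P$, with $\mathbb E_z h(Z_t)=\int h\,dP^t(z,\cdot)$. **Decision problem.** At each date $t\ge 0$ an agent is active or passive. When active, he observes the history up to date $t$ (including $Z_t$) and chooses whether to continue or to exit. Continuing yields the current payoff $c(Z_t)$, and he is active at $t+1$. Exiting yields the current payoff $s(Z_t)$ and puts him in the passive state at once. In the passive state at date $t$ he has no action available, receives $s(Z_t)$, and is active at date $t+1$ with probability $\alpha$ (independently of everything else) and passive at date $t+1$ with probability $1-\alpha$; exiting at $t$ leads to the same return lottery. A policy is a sequence of measurable functions of the history. Future payoffs are discounted by $\beta$. Let $v^*(z)$ and $r^*(z)$ be the suprema, over all policies, of the expected total discounted payoff starting from $Z_0=z$ in the active and in the passive state respectively, and put $\psi^*:=c+\beta Pv^*$. **Assumption.**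 There are a measurable $g\colon\mathsf Z\to[0,\infty)$, an integer $n\ge 0$ and constants $m,d\ge 0$ such that $\beta m<1$ and, for all $z\in\mathsf Z$, $$\max\Big\{\int |s|\,dP^n(z,\cdot),\ \int |c|\,dP^n(z,\cdot)\Big\}\le g(z),\qquad \int g(z')\,P(z,dz')\le m\,g(z)+d .$$ Moreover $\mathbb E_z|s(Z_t)|$ and $\mathbb E_z|c(Z_t)|$ are finite for all $z\in\mathsf Z$ and $0\le t<n$. Let $m',d'>0$ be such that $m+2m'>1$, $\beta(m+2m')<1$ and $d'\ge d/(m+2m'-1)$, and define $$\kappa(z):=m'\sum_{t=0}^{n-1}\mathbb E_z\big[|s(Z_t)|+|c(Z_t)|\big]+g(z)+d' .$$ Let $b_\kappa\mathsf Z$ be the set of measurable $f\colon\mathsf Z\to\mathbb R$ with $\|f\|_\kappa:=\sup_z|f(z)|/\kappa(z)<\infty$, equip $b_\kappa\mathsf Z\times b_\kappa\mathsf Z$ with the metric $\rho_\kappa((\psi,r),(\psi',r'))=\max\{\|\psi-\psi'\|_\kappa,\|r-r'\|_\kappa\}$, and let $$L(\psi,r)=\big(c+\beta P(r\vee\psi),\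 s+\alpha\beta P(r\vee\psi)+(1-\alpha)\beta Pr\big).$$ **Theorem.** The quantities above are well defined: from every initial state and under every policy the total discounted payoff converges absolutely almost surely and is integrable; the suprema that define $v^*$ and $r^*$ are finite; and $v^*$, as well as every $f\in b_\kappa\mathsf Z$, is $P(z,\cdot)$-integrable for every $z$. Moreover: 1. $L$ maps $b_\kappa\mathsf Z\times b_\kappa\mathsf Z$ into itself and is a contraction mapping on $(b_\kappa\mathsf Z\times b_\kappa\mathsf Z,\rho_\kappa)$ with modulus $\beta(m+2m')<1$. 2. $(\psi^*,r^*)$ lies in $b_\kappa\mathsf Z\times b_\kappa\mathsf Z$ and is the unique fixed point of $L$ there. -/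

import Mathlib

open MeasureTheory ProbabilityTheory Set
open scoped ENNReal

noncomputable section

namespace RepeatedDecision

variable {Z : Type*} [MeasurableSpace Z]

/-! ### The decision problem

The state at each date is a pair `(z, a)`, where `z` is the value of the exogenous Markov state and
`a : Bool` is the status of the agent: `true` for active, `false` for passive. -/

/-- The states observed at the dates `0, …, t`. -/
abbrev History (Z : Type*) (t : ℕ) : Type _ := Finset.Iic t → Z × Bool

/-- The last state of a history. -/
def lastState {t : ℕ} (h : History Z t) : Z × Bool := h ⟨t, Finset.mem_Iic.2 le_rfl⟩

/-- A (history-dependent) policy of the agent: at each date `t` a measurable rule that tells, given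
the history, whether to exit. The rule has an effect only at dates at which the agent is active. -/
structure Policy (Z : Type*) [MeasurableSpace Z] where
  exit : (t : ℕ) → History Z t → Bool
  measurable_exit : ∀ t, Measurable (exit t)

/-- The event that the agent continues at date `t`: he is active and does not exit.
Otherwise he is passive from date `t` on, either by exiting at `t` or because he has not yet
returned to the active state. -/
def continues (σ : Policy Z) (t : ℕ) : Set (History Z t) :=
  {h | (lastState h).2 = true ∧ σ.exit t h = false}

theorem measurable_lastState (t : ℕ) : Measurable (lastState : History Z t → Z × Bool) :=
  measurable_pi_apply _

theorem measurableSet_continues (σ : Policy Z) (t : ℕ) : MeasurableSet (continues σ t) :=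
  ((measurable_lastState t).snd (measurableSet_singleton true)).inter
    (σ.measurable_exit t (measurableSet_singleton false))

open Classical in
/-- The law of next period's status given the history: the agent remains active after continuing,
and is active with probability `α` after a period spent in the passive state. -/
def statusKernel (α : unitInterval) (σ : Policy Z) (t : ℕ) : Kernel (History Z t) Bool :=
  Kernel.piecewise (measurableSet_continues σ t)
    (Kernel.const _ (Measure.dirac true)) (Kernel.const _ (bernoulliMeasure true false α))

instance (α : unitInterval) (σ : Policy Z) (t : ℕ) : IsMarkovKernel (statusKernel α σ t) := by
  classical
  unfold statusKernel; infer_instance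

/-- The law of next period's state given the history: the exogenous state moves according to the
stochastic kernel `P`, and independently the status moves according to `statusKernel`. -/
def stepKernel (P : Kernel Z Z) (α : unitInterval) (σ : Policy Z) (t : ℕ) :
    Kernel (History Z t) (Z × Bool) :=
  (P.comap (fun h : History Z t => (lastState h).1) (measurable_lastState t).fst) ×ₖ
    statusKernel α σ t

instance (P : Kernel Z Z) [IsMarkovKernel P] (α : unitInterval) (σ : Policy Z) (t : ℕ) :
    IsMarkovKernel (stepKernel P α σ t) := by
  unfold stepKernel; infer_instance

/-- The law of the whole sequence of states under the policy `σ`, started at `x`. -/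
def pathLaw (P : Kernel Z Z) [IsMarkovKernel P] (α : unitInterval) (σ : Policy Z) (x : Z × Bool) :
    Measure (ℕ → Z × Bool) :=
  Kernel.traj (X := fun _ : ℕ => Z × Bool) (stepKernel P α σ) 0 (fun _ => x)

/-- The part of a path that is observed up to date `t`. -/
def historyAt (t : ℕ) (ω : ℕ → Z × Bool) : History Z t := fun i => ω i

open Classical in
/-- The payoff at date `t`: `c(Z_t)` if the agent continues, `s(Z_t)` if he exits or is passive. -/
def payoff (s c : Z → ℝ) (σ : Policy Z) (t : ℕ) (ω : ℕ → Z × Bool) : ℝ :=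
  if historyAt t ω ∈ continues σ t then c (ω t).1 else s (ω t).1

/-- Total discounted payoff along a path. -/
def lifetimePayoff (β : ℝ) (s c : Z → ℝ) (σ : Policy Z) (ω : ℕ → Z × Bool) : ℝ :=
  ∑' t : ℕ, β ^ t * payoff s c σ t ω

/-- Expected total discounted payoff of the policy `σ` from the initial state `x`. -/
def policyValue (P : Kernel Z Z) [IsMarkovKernel P] (α : unitInterval) (β : ℝ) (s c : Z → ℝ)
    (σ : Policy Z) (x : Z × Bool) : ℝ :=
  ∫ ω, lifetimePayoff β s c σ ω ∂(pathLaw P α σ x)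

/-- `v*(z)`: the maximal discounted value starting at `z` in the active state. -/
def activeValue (P : Kernel Z Z) [IsMarkovKernel P] (α : unitInterval) (β : ℝ) (s c : Z → ℝ)
    (z : Z) : ℝ :=
  ⨆ σ : Policy Z, policyValue P α β s c σ (z, true)

/-- `r*(z)`: the maximal discounted value starting at `z` in the passive state. -/
def passiveValue (P : Kernel Z Z) [IsMarkovKernel P] (α : unitInterval) (β : ℝ) (s c : Z → ℝ)
    (z : Z) : ℝ :=
  ⨆ σ : Policy Z, policyValue P α β s c σ (z, false)

/-- `ψ* = c + β P v*`: the continuation value. -/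
def continuationValue (P : Kernel Z Z) [IsMarkovKernel P] (α : unitInterval) (β : ℝ)
    (s c : Z → ℝ) (z : Z) : ℝ :=
  c z + β * ∫ z', activeValue P α β s c z' ∂(P z)

/-! ### The drift assumption, weighted spaces and the operator -/

/-- The drift assumption, with witnesses `g`, `n`, `m`, `d`. The integrals are Lebesgue integrals of
nonnegative functions, with values in `[0, ∞]`; `P ^ n` is the `n`-step kernel. -/
structure DriftAssumption (P : Kernel Z Z) (β : ℝ) (s c g : Z → ℝ) (n : ℕ) (m d : ℝ) : Prop where
  measurable_g : Measurable g
  g_nonneg : ∀ z, 0 ≤ g z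
  m_nonneg : 0 ≤ m
  d_nonneg : 0 ≤ d
  beta_mul_m_lt_one : β * m < 1
  lintegral_le : ∀ z,
    max (∫⁻ z', ‖s z'‖ₑ ∂((P ^ n) z)) (∫⁻ z', ‖c z'‖ₑ ∂((P ^ n) z)) ≤ ENNReal.ofReal (g z)
  drift : ∀ z, ∫⁻ z', ENNReal.ofReal (g z') ∂(P z) ≤ ENNReal.ofReal (m * g z + d)

/-- The weight function `κ(z) = m' ∑_{t<n} E_z[|s(Z_t)| + |c(Z_t)|] + g(z) + d'`. -/
def weight (P : Kernel Z Z) (s c g : Z → ℝ) (n : ℕ) (m' d' : ℝ) (z : Z) : ℝ :=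
  m' * ∑ t ∈ Finset.range n, ∫ z', (|s z'| + |c z'|) ∂((P ^ t) z) + g z + d'

/-- The `κ`-weighted supremum norm. -/
def weightedNorm (κ f : Z → ℝ) : ℝ := ⨆ z, |f z| / κ z

/-- The space of measurable `κ`-bounded functions. -/
def weightedBounded (κ : Z → ℝ) : Set (Z → ℝ) :=
  {f | Measurable f ∧ BddAbove (range fun z => |f z| / κ z)}

/-- The metric `ρ_κ` on the product of two copies of `weightedBounded κ`. -/
def weightedDist (κ : Z → ℝ) (h h' : (Z → ℝ) × (Z → ℝ)) : ℝ :=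
  max (weightedNorm κ (h.1 - h'.1)) (weightedNorm κ (h.2 - h'.2))

/-- The operator `L(ψ, r) = (c + β P(r ∨ ψ), s + α β P(r ∨ ψ) + (1 - α) β P r)`. -/
def opL (P : Kernel Z Z) (α : unitInterval) (β : ℝ) (s c : Z → ℝ) (h : (Z → ℝ) × (Z → ℝ)) :
    (Z → ℝ) × (Z → ℝ) :=
  (fun z => c z + β * ∫ z', max (h.2 z') (h.1 z') ∂(P z),
   fun z => s z + (α : ℝ) * β * ∫ z', max (h.2 z') (h.1 z') ∂(P z)
      + (1 - (α : ℝ)) * β * ∫ z', h.2 z' ∂(P z))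

/-- `T` is a contraction mapping on `S`, with respect to the metric `ρ`, with modulus `k`. -/
def IsContractionOn {E : Type*} (ρ : E → E → ℝ) (T : E → E) (S : Set E) (k : ℝ) : Prop :=
  0 ≤ k ∧ k < 1 ∧ MapsTo T S S ∧ ∀ x ∈ S, ∀ y ∈ S, ρ (T x) (T y) ≤ k * ρ x y

end RepeatedDecision

end

namespace RepeatedDecision

open Filter Topology

/-! Write M = m + 2m'. The weight κ satisfies Pκ ≤ Mκ (`isWeight_weight`) and dominates |s| and |c|
up to a constant (`abs_le_mul_weight`). Hence P multiplies κ-bounds by at most M. Since the maximum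
is nonexpansive and αβ + (1-α)β = β, `opL` contracts with modulus βM (`IsWeight.opL_sub_le`), and
its iterates converge to a fixed point (`IsWeight.exists_fixedPoint`).

A verification argument identifies any κ-bounded fixed point (ψ, r) with the value. Let W be r ∨ ψ
in the active and r in the passive state. By the fixed point equation, the payoff at date t plus β
times the conditional expectation of W at t+1 is ψ if the agent continues and r otherwise. This is
at most W at t, with equality if he exits exactly when ψ ≤ r. Discounting, summing and telescoping
(`IsWeight.tendsto_sum_step`) leaves the remainder β^T E[W(X_T)], where X_T is the state at date T;
it vanishes because E[κ(Z_T)] ≤ M^T κ(Z_0) under every policy. So W is the maximal policy value and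
is attained, which gives r = r*, r ∨ ψ = v* and ψ = ψ*. As the fixed point was arbitrary, this also
proves uniqueness. -/

theorem weightedNorm_le {Z : Type*} {κ : Z → ℝ} (hpos : ∀ z, 0 < κ z) {f : Z → ℝ} {C : ℝ}
    (hC : 0 ≤ C) (hf : ∀ z, |f z| ≤ C * κ z) : weightedNorm κ f ≤ C :=
  -- The bound `hC` covers an empty `Z`, where the real supremum is 0.
  Real.iSup_le (fun z => (div_le_iff₀ (hpos z)).2 (hf z)) hC

theorem weightedNorm_nonneg {Z : Type*} {κ : Z → ℝ} (hpos : ∀ z, 0 < κ z) (f : Z → ℝ) :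
    0 ≤ weightedNorm κ f :=
  Real.iSup_nonneg fun z => div_nonneg (abs_nonneg _) (hpos z).le

theorem lastState_historyAt {Z : Type*} (t : ℕ) (ω : ℕ → Z × Bool) :
    lastState (historyAt t ω) = ω t := rfl

variable {Z : Type*} [MeasurableSpace Z]

/-! ### Weight functions satisfying a multiplicative drift inequality -/

/-- A positive measurable function whose `P`-average grows by at most the factor `M`. -/
structure IsWeight (P : Kernel Z Z) (M : ℝ) (κ : Z → ℝ) : Prop where
  measurable : Measurable κ
  pos : ∀ z, 0 < κ z
  lintegral_le : ∀ z, ∫⁻ z', ENNReal.ofReal (κ z') ∂(P z) ≤ ENNReal.ofReal (M * κ z)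

/-- Chapman–Kolmogorov with the first step split off, so that averaging the t-th term of κ over P
yields the next term. -/
theorem lintegral_pow_succ (P : Kernel Z Z) (t : ℕ) (z : Z) {f : Z → ℝ≥0∞} (hf : Measurable f) :
    ∫⁻ z', f z' ∂((P ^ (t + 1)) z) = ∫⁻ y, ∫⁻ z', f z' ∂((P ^ t) y) ∂(P z) := by
  rw [Kernel.pow_add, pow_one, Kernel.lintegral_comp _ _ _ hf]

/-- In `[0, ∞]` the weight can be integrated term by term without integrability conditions.
Finiteness of the expectations for t < n makes the real integrals in κ agree with the Lebesgue ones.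
-/
theorem ofReal_weight {P : Kernel Z Z} {s c g : Z → ℝ} {n : ℕ}
    (hg : ∀ z, 0 ≤ g z)
    (hfin : ∀ t < n, ∀ z, Integrable s ((P ^ t) z) ∧ Integrable c ((P ^ t) z))
    {m' d' : ℝ} (hm' : 0 ≤ m') (hd' : 0 ≤ d') (z : Z) :
    ENNReal.ofReal (weight P s c g n m' d' z) =
      ENNReal.ofReal m' * ∑ t ∈ Finset.range n, ∫⁻ z', (‖s z'‖ₑ + ‖c z'‖ₑ) ∂((P ^ t) z) +
        ENNReal.ofReal (g z) + ENNReal.ofReal d' := by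
  have hint : ∀ t, 0 ≤ ∫ z', (|s z'| + |c z'|) ∂((P ^ t) z) := fun t =>
    integral_nonneg fun _ => by positivity
  have hsum : 0 ≤ ∑ t ∈ Finset.range n, ∫ z', (|s z'| + |c z'|) ∂((P ^ t) z) :=
    Finset.sum_nonneg fun t _ => hint t
  rw [weight, ENNReal.ofReal_add (add_nonneg (mul_nonneg hm' hsum) (hg z)) hd',
    ENNReal.ofReal_add (mul_nonneg hm' hsum) (hg z), ENNReal.ofReal_mul hm',
    ENNReal.ofReal_sum_of_nonneg fun t _ => hint t]
  congr 3
  refine Finset.sum_congr rfl fun t ht => ?_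
  obtain ⟨h1, h2⟩ := hfin t (Finset.mem_range.1 ht) z
  rw [ofReal_integral_eq_lintegral_ofReal (f := fun a => |s a| + |c a|) (h1.abs.add h2.abs)
    (ae_of_all _ fun _ => by positivity)]
  refine lintegral_congr fun y => ?_
  rw [ENNReal.ofReal_add (abs_nonneg _) (abs_nonneg _), Real.enorm_eq_ofReal_abs,
    Real.enorm_eq_ofReal_abs]

theorem measurable_weight {P : Kernel Z Z} {s c g : Z → ℝ} (hs : Measurable s)
    (hc : Measurable c) (hg : Measurable g) (n : ℕ) (m' d' : ℝ) :
    Measurable (weight P s c g n m' d') := by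
  have h : ∀ t : ℕ, Measurable fun z => ∫ z', (|s z'| + |c z'|) ∂((P ^ t) z) := by
    intro t
    have hm : Measurable fun z => |s z| + |c z| := by fun_prop
    have : (fun z => ∫ z', (|s z'| + |c z'|) ∂((P ^ t) z)) =
        fun z => (∫⁻ z', ENNReal.ofReal (|s z'| + |c z'|) ∂((P ^ t) z)).toReal := by
      funext z
      exact integral_eq_lintegral_of_nonneg_ae (ae_of_all _ fun _ => by positivity)
        hm.aestronglyMeasurable
    rw [this]
    exact (Measurable.lintegral_kernel hm.ennreal_ofReal).ennreal_toReal
  unfold weight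
  fun_prop

/-- Averaging shifts the sum in κ by one date: the term t = 0 is lost and the term t = n, at most
2g, is gained. The coefficient of g thus becomes m + 2m', the sum keeps a coefficient 1 ≤ m + 2m',
and the choice of d' absorbs d. -/
theorem isWeight_weight {P : Kernel Z Z} [IsMarkovKernel P] {β : ℝ} {s c g : Z → ℝ}
    (hs : Measurable s) (hc : Measurable c) {n : ℕ} {m d : ℝ}
    (hdrift : DriftAssumption P β s c g n m d)
    (hfin : ∀ t < n, ∀ z, Integrable s ((P ^ t) z) ∧ Integrable c ((P ^ t) z))
    {m' d' : ℝ} (hm' : 0 < m') (hd' : 0 < d') (h1 : 1 < m + 2 * m')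
    (h3 : d / (m + 2 * m' - 1) ≤ d') :
    IsWeight P (m + 2 * m') (weight P s c g n m' d') := by
  have hsum : ∀ z, 0 ≤ ∑ t ∈ Finset.range n, ∫ z', (|s z'| + |c z'|) ∂((P ^ t) z) := fun z =>
    Finset.sum_nonneg fun t _ => integral_nonneg fun _ => by positivity
  refine ⟨measurable_weight hs hc hdrift.measurable_g n m' d', fun z => ?_, fun z => ?_⟩
  · have := mul_nonneg hm'.le (hsum z)
    have := hdrift.g_nonneg z
    unfold weight
    linarith
  have hsc : Measurable fun z => ‖s z‖ₑ + ‖c z‖ₑ := by fun_prop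
  have hA : ∀ t, Measurable fun z => ∫⁻ z', (‖s z'‖ₑ + ‖c z'‖ₑ) ∂((P ^ t) z) := fun t =>
    Measurable.lintegral_kernel hsc
  have hgm := hdrift.measurable_g
  have hd : d + d' ≤ (m + 2 * m') * d' := by
    rw [div_le_iff₀ (by linarith)] at h3
    linarith
  simp_rw [ofReal_weight hdrift.g_nonneg hfin hm'.le hd'.le]
  rw [lintegral_add_right _ measurable_const, lintegral_add_right _ (by fun_prop),
    lintegral_const_mul _ (by fun_prop), lintegral_finsetSum _ (fun t _ => hA t)]
  simp_rw [← lintegral_pow_succ P _ z hsc]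
  have hlast : ∫⁻ z', (‖s z'‖ₑ + ‖c z'‖ₑ) ∂((P ^ n) z) ≤ ENNReal.ofReal (2 * g z) := by
    rw [lintegral_add_left (by fun_prop), two_mul,
      ENNReal.ofReal_add (hdrift.g_nonneg z) (hdrift.g_nonneg z)]
    exact add_le_add ((le_max_left _ _).trans (hdrift.lintegral_le z))
      ((le_max_right _ _).trans (hdrift.lintegral_le z))
  have hshift : ∑ t ∈ Finset.range n, ∫⁻ z', (‖s z'‖ₑ + ‖c z'‖ₑ) ∂((P ^ (t + 1)) z) ≤
      ∑ t ∈ Finset.range n, ∫⁻ z', (‖s z'‖ₑ + ‖c z'‖ₑ) ∂((P ^ t) z) + ENNReal.ofReal (2 * g z) := by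
    refine le_trans ?_ (add_le_add_right hlast _)
    rw [← Finset.sum_range_succ, Finset.sum_range_succ' _ n]
    exact le_self_add
  -- The sum alone is the weight with m' = 1, g = 0 and d' = 0.
  have hsumreal : ∑ t ∈ Finset.range n, ∫⁻ z', (‖s z'‖ₑ + ‖c z'‖ₑ) ∂((P ^ t) z) =
      ENNReal.ofReal (∑ t ∈ Finset.range n, ∫ z', (|s z'| + |c z'|) ∂((P ^ t) z)) := by
    have := ofReal_weight (g := fun _ => 0) (fun _ => le_rfl) hfin zero_le_one le_rfl z
    simpa [weight] using this.symm
  have hg0 := hdrift.g_nonneg z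
  have hm0 := hdrift.m_nonneg
  have hd0 := hdrift.d_nonneg
  calc _ ≤ ENNReal.ofReal m' * (∑ t ∈ Finset.range n, ∫⁻ z', (‖s z'‖ₑ + ‖c z'‖ₑ) ∂((P ^ t) z) +
          ENNReal.ofReal (2 * g z)) + ENNReal.ofReal (m * g z + d) + ENNReal.ofReal d' := by
        gcongr
        · exact hdrift.drift z
        · simp
    _ = ENNReal.ofReal (m' * (∑ t ∈ Finset.range n, ∫ z', (|s z'| + |c z'|) ∂((P ^ t) z) +
          2 * g z) + (m * g z + d) + d') := by
        rw [hsumreal, ← ENNReal.ofReal_add (hsum z) (by positivity),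
          ← ENNReal.ofReal_mul hm'.le, ← ENNReal.ofReal_add, ← ENNReal.ofReal_add]
        · have := hsum z
          positivity
        · exact hd'.le
        · have := hsum z
          positivity
        · positivity
    _ ≤ _ := by
        apply ENNReal.ofReal_le_ofReal
        have := mul_le_mul_of_nonneg_right h1.le (mul_nonneg hm'.le (hsum z))
        unfold weight
        linarith

/-- For n ≥ 1 the term t = 0 of κ is m'(|s| + |c|), hence the factor 1/m'. For n = 0 the sum is
empty, but the assumption itself reads |s|, |c| ≤ g, hence the factor 1. -/
theorem abs_le_mul_weight {P : Kernel Z Z} {β : ℝ} {s c g : Z → ℝ}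
    (hs : Measurable s) (hc : Measurable c) {n : ℕ} {m d : ℝ}
    (hdrift : DriftAssumption P β s c g n m d) {m' d' : ℝ} (hm' : 0 < m') (hd' : 0 < d') (z : Z) :
    |s z| ≤ max 1 (1 / m') * weight P s c g n m' d' z ∧
      |c z| ≤ max 1 (1 / m') * weight P s c g n m' d' z := by
  have hg := hdrift.g_nonneg z
  have hK1 := le_max_left 1 (1 / m')
  have hK2 : 1 ≤ max 1 (1 / m') * m' := by
    rw [← div_le_iff₀ hm']
    exact le_max_right _ _
  have h0 : 0 ≤ max 1 (1 / m') * d' := by positivity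
  have hge : g z ≤ max 1 (1 / m') * g z := le_mul_of_one_le_left hg hK1
  unfold weight
  cases n with
  | zero =>
    have h := hdrift.lintegral_le z
    have key : ∀ f : Z → ℝ, Measurable f →
        ∫⁻ z', ‖f z'‖ₑ ∂((P ^ 0) z) ≤ ENNReal.ofReal (g z) → |f z| ≤ g z := by
      intro f hf hle
      rw [pow_zero, show (1 : Kernel Z Z) = Kernel.id from rfl, Kernel.id_apply,
        lintegral_dirac' _ (by fun_prop), Real.enorm_eq_ofReal_abs,
        ENNReal.ofReal_le_ofReal_iff hg] at hle
      exact hle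
    have h1 := key s hs ((le_max_left _ _).trans h)
    have h2 := key c hc ((le_max_right _ _).trans h)
    simp only [Finset.range_zero, Finset.sum_empty, mul_zero]
    constructor <;> linarith
  | succ k =>
    have hsum : |s z| + |c z| ≤
        ∑ t ∈ Finset.range (k + 1), ∫ z', (|s z'| + |c z'|) ∂((P ^ t) z) := by
      have h0 : ∫ z', (|s z'| + |c z'|) ∂((P ^ 0) z) = |s z| + |c z| := by
        rw [pow_zero, show (1 : Kernel Z Z) = Kernel.id from rfl, Kernel.id_apply,
          integral_dirac' _ _ (by fun_prop)]
      rw [← h0]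
      exact Finset.single_le_sum
        (f := fun t => ∫ z', (|s z'| + |c z'|) ∂((P ^ t) z))
        (fun t _ => integral_nonneg fun _ => by positivity) (Finset.mem_range.2 k.succ_pos)
    have h2 := mul_le_mul hK2 hsum (by positivity) (by positivity)
    have := abs_nonneg (s z)
    have := abs_nonneg (c z)
    constructor <;> linarith

/-! ### Contraction estimate and fixed point in the weighted space -/

section Weighted

variable {P : Kernel Z Z} {M : ℝ} {κ : Z → ℝ}

theorem IsWeight.integrable (hκ : IsWeight P M κ) (z : Z) : Integrable κ (P z) := by
  refine ⟨hκ.measurable.aestronglyMeasurable, ?_⟩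
  rw [hasFiniteIntegral_iff_ofReal (ae_of_all _ fun z => (hκ.pos z).le)]
  exact (hκ.lintegral_le z).trans_lt ENNReal.ofReal_lt_top

theorem IsWeight.integral_le (hκ : IsWeight P M κ) (hM : 0 ≤ M) (z : Z) :
    ∫ z', κ z' ∂(P z) ≤ M * κ z := by
  rw [integral_eq_lintegral_of_nonneg_ae (ae_of_all _ fun z => (hκ.pos z).le)
    hκ.measurable.aestronglyMeasurable]
  exact ENNReal.toReal_le_of_le_ofReal (mul_nonneg hM (hκ.pos z).le) (hκ.lintegral_le z)

theorem mem_weightedBounded_iff (hpos : ∀ z, 0 < κ z) {f : Z → ℝ} :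
    f ∈ weightedBounded κ ↔ Measurable f ∧ ∃ C, 0 ≤ C ∧ ∀ z, |f z| ≤ C * κ z := by
  refine and_congr_right fun _ => ⟨?_, ?_⟩
  · rintro ⟨C, hC⟩
    refine ⟨max C 0, le_max_right _ _, fun z => ?_⟩
    rw [← div_le_iff₀ (hpos z)]
    exact (hC ⟨z, rfl⟩).trans (le_max_left _ _)
  · rintro ⟨C, -, hC⟩
    refine ⟨C, ?_⟩
    rintro _ ⟨z, rfl⟩
    exact (div_le_iff₀ (hpos z)).2 (hC z)

theorem abs_le_weightedNorm_mul (hpos : ∀ z, 0 < κ z) {f : Z → ℝ} (hf : f ∈ weightedBounded κ)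
    (z : Z) : |f z| ≤ weightedNorm κ f * κ z :=
  (div_le_iff₀ (hpos z)).1 (le_ciSup hf.2 z)

theorem sub_mem_weightedBounded (hpos : ∀ z, 0 < κ z) {f f' : Z → ℝ}
    (hf : f ∈ weightedBounded κ) (hf' : f' ∈ weightedBounded κ) :
    f - f' ∈ weightedBounded κ := by
  rw [mem_weightedBounded_iff hpos] at *
  obtain ⟨hm, C, hC, h⟩ := hf
  obtain ⟨hm', C', hC', h'⟩ := hf'
  refine ⟨hm.sub hm', C + C', by positivity, fun z => ?_⟩
  rw [add_mul]
  exact (abs_sub _ _).trans (add_le_add (h z) (h' z))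

theorem max_mem_weightedBounded (hpos : ∀ z, 0 < κ z) {f f' : Z → ℝ}
    (hf : f ∈ weightedBounded κ) (hf' : f' ∈ weightedBounded κ) :
    (fun z => max (f z) (f' z)) ∈ weightedBounded κ := by
  rw [mem_weightedBounded_iff hpos] at *
  obtain ⟨hm, C, hC, h⟩ := hf
  obtain ⟨hm', C', hC', h'⟩ := hf'
  refine ⟨hm.max hm', max C C', le_max_of_le_left hC, fun z => ?_⟩
  have hz := (hpos z).le
  exact abs_max_le_max_abs_abs.trans (max_le
    ((h z).trans (mul_le_mul_of_nonneg_right (le_max_left _ _) hz))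
    ((h' z).trans (mul_le_mul_of_nonneg_right (le_max_right _ _) hz)))

theorem IsWeight.integrable_of_mem (hκ : IsWeight P M κ) {f : Z → ℝ}
    (hf : f ∈ weightedBounded κ) (z : Z) : Integrable f (P z) := by
  obtain ⟨hm, C, -, h⟩ := (mem_weightedBounded_iff hκ.pos).1 hf
  exact ((hκ.integrable z).const_mul C).mono' hm.aestronglyMeasurable (ae_of_all _ h)

theorem IsWeight.abs_integral_le (hκ : IsWeight P M κ) (hM : 0 ≤ M) {f : Z → ℝ} {C : ℝ}
    (hC : 0 ≤ C) (hf : ∀ z, |f z| ≤ C * κ z) (z : Z) :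
    |∫ z', f z' ∂(P z)| ≤ M * C * κ z := by
  have h1 : |∫ z', f z' ∂(P z)| ≤ ∫ z', C * κ z' ∂(P z) :=
    norm_integral_le_of_norm_le (f := f) ((hκ.integrable z).const_mul C) (ae_of_all _ hf)
  rw [integral_const_mul] at h1
  calc _ ≤ _ := h1
    _ ≤ C * (M * κ z) := mul_le_mul_of_nonneg_left (hκ.integral_le hM z) hC
    _ = _ := by ring

theorem IsWeight.integral_mem (hκ : IsWeight P M κ) (hM : 0 ≤ M) {f : Z → ℝ}
    (hf : f ∈ weightedBounded κ) : (fun z => ∫ z', f z' ∂(P z)) ∈ weightedBounded κ := by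
  obtain ⟨hm, C, hC, h⟩ := (mem_weightedBounded_iff hκ.pos).1 hf
  refine (mem_weightedBounded_iff hκ.pos).2
    ⟨(hm.stronglyMeasurable.integral_kernel).measurable, M * C, by positivity, fun z =>
      hκ.abs_integral_le hM hC h z⟩

theorem add_mem_weightedBounded (hpos : ∀ z, 0 < κ z) {f f' : Z → ℝ}
    (hf : f ∈ weightedBounded κ) (hf' : f' ∈ weightedBounded κ) :
    (fun z => f z + f' z) ∈ weightedBounded κ := by
  rw [mem_weightedBounded_iff hpos] at *
  obtain ⟨hm, C, hC, h⟩ := hf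
  obtain ⟨hm', C', hC', h'⟩ := hf'
  refine ⟨hm.add hm', C + C', by positivity, fun z => ?_⟩
  rw [add_mul]
  exact (abs_add_le _ _).trans (add_le_add (h z) (h' z))

theorem const_mul_mem_weightedBounded (hpos : ∀ z, 0 < κ z) {f : Z → ℝ} (a : ℝ)
    (hf : f ∈ weightedBounded κ) : (fun z => a * f z) ∈ weightedBounded κ := by
  rw [mem_weightedBounded_iff hpos] at *
  obtain ⟨hm, C, hC, h⟩ := hf
  refine ⟨hm.const_mul a, |a| * C, by positivity, fun z => ?_⟩
  rw [abs_mul, mul_assoc]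
  exact mul_le_mul_of_nonneg_left (h z) (abs_nonneg a)

theorem IsWeight.opL_mapsTo (hκ : IsWeight P M κ) (hM : 0 ≤ M) (α : unitInterval) (β : ℝ)
    {s c : Z → ℝ} (hs : s ∈ weightedBounded κ) (hc : c ∈ weightedBounded κ) :
    MapsTo (opL P α β s c) (weightedBounded κ ×ˢ weightedBounded κ)
      (weightedBounded κ ×ˢ weightedBounded κ) := by
  rintro h ⟨h1, h2⟩
  have hmax := hκ.integral_mem hM (max_mem_weightedBounded hκ.pos h2 h1)
  have hr := hκ.integral_mem hM h2
  exact ⟨add_mem_weightedBounded hκ.pos hc (const_mul_mem_weightedBounded hκ.pos _ hmax),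
    add_mem_weightedBounded hκ.pos
      (add_mem_weightedBounded hκ.pos hs (const_mul_mem_weightedBounded hκ.pos _ hmax))
      (const_mul_mem_weightedBounded hκ.pos _ hr)⟩

/-- Stated pointwise with a free constant C so that it serves the contraction property, the
increments of the iteration, and the distance from an iterate to the limit. -/
theorem IsWeight.opL_sub_le (hκ : IsWeight P M κ) (hM : 0 ≤ M) (α : unitInterval) {β : ℝ}
    (hβ : 0 ≤ β) {s c : Z → ℝ} {h h' : (Z → ℝ) × (Z → ℝ)}
    (hh : h ∈ weightedBounded κ ×ˢ weightedBounded κ)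
    (hh' : h' ∈ weightedBounded κ ×ˢ weightedBounded κ) {C : ℝ} (hC : 0 ≤ C)
    (h1 : ∀ z, |h.1 z - h'.1 z| ≤ C * κ z) (h2 : ∀ z, |h.2 z - h'.2 z| ≤ C * κ z) (z : Z) :
    |(opL P α β s c h).1 z - (opL P α β s c h').1 z| ≤ β * M * C * κ z ∧
      |(opL P α β s c h).2 z - (opL P α β s c h').2 z| ≤ β * M * C * κ z := by
  have hmax := hκ.abs_integral_le hM hC
    (f := fun z => max (h.2 z) (h.1 z) - max (h'.2 z) (h'.1 z)) (fun z =>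
      (abs_max_sub_max_le_max _ _ _ _).trans (max_le (h2 z) (h1 z))) z
  have hr := hκ.abs_integral_le hM hC (f := fun z => h.2 z - h'.2 z) h2 z
  rw [integral_sub (hκ.integrable_of_mem (max_mem_weightedBounded hκ.pos hh.2 hh.1) z)
    (hκ.integrable_of_mem (max_mem_weightedBounded hκ.pos hh'.2 hh'.1) z)] at hmax
  rw [integral_sub (hκ.integrable_of_mem hh.2 z) (hκ.integrable_of_mem hh'.2 z)] at hr
  have hα0 := α.2.1
  have hα1 : (0 : ℝ) ≤ 1 - α := sub_nonneg.2 α.2.2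
  simp only [opL]
  constructor
  · rw [add_sub_add_left_eq_sub, ← mul_sub, abs_mul, abs_of_nonneg hβ]
    calc _ ≤ β * (M * C * κ z) := by gcongr
      _ = _ := by ring
  · have key : ∀ a b a' b' : ℝ, |a - a'| ≤ M * C * κ z → |b - b'| ≤ M * C * κ z →
        |s z + α * β * a + (1 - α) * β * b - (s z + α * β * a' + (1 - α) * β * b')| ≤
          β * M * C * κ z := by
      intro a b a' b' ha hb
      have : s z + α * β * a + (1 - α) * β * b - (s z + α * β * a' + (1 - α) * β * b') =
          α * β * (a - a') + (1 - α) * β * (b - b') := by ring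
      rw [this]
      refine (abs_add_le _ _).trans ?_
      rw [abs_mul (α * β), abs_mul (_ * β), abs_of_nonneg (mul_nonneg hα0 hβ), abs_of_nonneg (mul_nonneg hα1 hβ)]
      calc _ ≤ α * β * (M * C * κ z) + (1 - α) * β * (M * C * κ z) := by gcongr
        _ = _ := by ring
    exact key _ _ _ _ hmax hr

theorem IsWeight.isContractionOn_opL (hκ : IsWeight P M κ) (hM : 0 ≤ M) (α : unitInterval) {β : ℝ}
    (hβ : 0 ≤ β) (hβM : β * M < 1) {s c : Z → ℝ} (hs : s ∈ weightedBounded κ)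
    (hc : c ∈ weightedBounded κ) :
    IsContractionOn (weightedDist κ) (opL P α β s c) (weightedBounded κ ×ˢ weightedBounded κ)
      (β * M) := by
  refine ⟨by positivity, hβM, hκ.opL_mapsTo hM α β hs hc, fun h hh h' hh' => ?_⟩
  have hC : 0 ≤ weightedDist κ h h' := le_max_of_le_left (weightedNorm_nonneg hκ.pos _)
  have key := hκ.opL_sub_le hM α hβ (s := s) (c := c) hh hh' hC
    (fun z => (abs_le_weightedNorm_mul hκ.pos (sub_mem_weightedBounded hκ.pos hh.1 hh'.1) z).trans
      (mul_le_mul_of_nonneg_right (le_max_left _ _) (hκ.pos z).le))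
    (fun z => (abs_le_weightedNorm_mul hκ.pos (sub_mem_weightedBounded hκ.pos hh.2 hh'.2) z).trans
      (mul_le_mul_of_nonneg_right (le_max_right _ _) (hκ.pos z).le))
  exact max_le (weightedNorm_le hκ.pos (by positivity) fun z => (key z).1)
    (weightedNorm_le hκ.pos (by positivity) fun z => (key z).2)

theorem zero_mem_weightedBounded (hpos : ∀ z, 0 < κ z) : (fun _ => 0) ∈ weightedBounded κ :=
  (mem_weightedBounded_iff hpos).2 ⟨measurable_const, 0, le_rfl, fun z => by simp⟩

/-- A sequence of `κ`-bounded functions whose increments decay geometrically converges to a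
`κ`-bounded function, at a geometric rate. -/
theorem exists_limit_of_geometric (hpos : ∀ z, 0 < κ z) {u : ℕ → Z → ℝ}
    (hu : ∀ k, u k ∈ weightedBounded κ) {C ρ : ℝ} (hC : 0 ≤ C) (hρ : ρ < 1)
    (h : ∀ k z, |u k z - u (k + 1) z| ≤ C * ρ ^ k * κ z) :
    ∃ v ∈ weightedBounded κ, ∀ k z, |u k z - v z| ≤ C / (1 - ρ) * ρ ^ k * κ z := by
  have h' : ∀ z k, dist (u k z) (u (k + 1) z) ≤ C * κ z * ρ ^ k := fun z k => by
    rw [Real.dist_eq]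
    calc _ ≤ _ := h k z
      _ = _ := by ring
  choose v hv using fun z => cauchySeq_tendsto_of_complete (cauchySeq_of_le_geometric _ _ hρ (h' z))
  have hle : ∀ k z, |u k z - v z| ≤ C / (1 - ρ) * ρ ^ k * κ z := fun k z => by
    rw [← Real.dist_eq]
    calc _ ≤ _ := dist_le_of_le_geometric_of_tendsto _ _ hρ (h' z) (hv z) k
      _ = _ := by ring
  refine ⟨v, (mem_weightedBounded_iff hpos).2
    ⟨measurable_of_tendsto_metrizable (fun k => (hu k).1) (tendsto_pi_nhds.2 hv), ?_⟩, hle⟩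
  obtain ⟨-, K, hK, hKu⟩ := (mem_weightedBounded_iff hpos).1 (hu 0)
  have hρ' : 0 ≤ 1 - ρ := by linarith
  refine ⟨K + C / (1 - ρ), by positivity, fun z => ?_⟩
  have h0 := hle 0 z
  rw [abs_sub_comm, pow_zero, mul_one] at h0
  have h1 := abs_sub_abs_le_abs_sub (v z) (u 0 z)
  have h2 := hKu z
  linarith

/-- Picard iteration from zero. The limit is fixed because u_{k+1} = L(u_k) tends pointwise both to
the limit and, by the contraction estimate, to its image under L. -/
theorem IsWeight.exists_fixedPoint (hκ : IsWeight P M κ) (hM : 0 ≤ M) (α : unitInterval) {β : ℝ}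
    (hβ : 0 ≤ β) (hβM : β * M < 1) {s c : Z → ℝ} (hs : s ∈ weightedBounded κ)
    (hc : c ∈ weightedBounded κ) :
    ∃ h ∈ weightedBounded κ ×ˢ weightedBounded κ, opL P α β s c h = h := by
  have hρ : 0 ≤ β * M := by positivity
  have hmaps := hκ.opL_mapsTo hM α β hs hc
  obtain ⟨u, hu0, hu1⟩ : ∃ u : ℕ → (Z → ℝ) × (Z → ℝ), u 0 = (fun _ => 0, fun _ => 0) ∧
      ∀ k, u (k + 1) = opL P α β s c (u k) :=
    ⟨fun k => (opL P α β s c)^[k] (fun _ => 0, fun _ => 0), rfl, fun k =>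
      Function.iterate_succ_apply' _ _ _⟩
  have hu : ∀ k, u k ∈ weightedBounded κ ×ˢ weightedBounded κ := by
    intro k
    induction k with
    | zero =>
      rw [hu0]
      exact ⟨zero_mem_weightedBounded hκ.pos, zero_mem_weightedBounded hκ.pos⟩
    | succ k ih =>
      rw [hu1]
      exact hmaps ih
  obtain ⟨C, hC, hC1⟩ : ∃ C, 0 ≤ C ∧ ∀ z, |(u 0).1 z - (u 1).1 z| ≤ C * κ z ∧
      |(u 0).2 z - (u 1).2 z| ≤ C * κ z := by
    obtain ⟨-, A, hA, h1⟩ := (mem_weightedBounded_iff hκ.pos).1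
      (sub_mem_weightedBounded hκ.pos (hu 0).1 (hu 1).1)
    obtain ⟨-, B, hB, h2⟩ := (mem_weightedBounded_iff hκ.pos).1
      (sub_mem_weightedBounded hκ.pos (hu 0).2 (hu 1).2)
    exact ⟨max A B, le_max_of_le_left hA, fun z =>
      ⟨(h1 z).trans (mul_le_mul_of_nonneg_right (le_max_left _ _) (hκ.pos z).le),
        (h2 z).trans (mul_le_mul_of_nonneg_right (le_max_right _ _) (hκ.pos z).le)⟩⟩
  have hstep : ∀ k z, |(u k).1 z - (u (k + 1)).1 z| ≤ C * (β * M) ^ k * κ z ∧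
      |(u k).2 z - (u (k + 1)).2 z| ≤ C * (β * M) ^ k * κ z := by
    intro k
    induction k with
    | zero => simpa using hC1
    | succ k ih =>
      intro z
      have := hκ.opL_sub_le hM α hβ (s := s) (c := c) (hu k) (hu (k + 1))
        (by positivity : 0 ≤ C * (β * M) ^ k) (fun z => (ih z).1) (fun z => (ih z).2) z
      rw [← hu1, ← hu1] at this
      rwa [show C * (β * M) ^ (k + 1) = β * M * (C * (β * M) ^ k) by ring]
  obtain ⟨ψ, hψ, hψu⟩ := exists_limit_of_geometric hκ.pos (fun k => (hu k).1) hC hβM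
    fun k z => (hstep k z).1
  obtain ⟨r, hr, hru⟩ := exists_limit_of_geometric hκ.pos (fun k => (hu k).2) hC hβM
    fun k z => (hstep k z).2
  have hden : 0 ≤ 1 - β * M := by linarith
  have hlim : ∀ z, Tendsto (fun k : ℕ => C / (1 - β * M) * (β * M) ^ k * κ z) atTop (𝓝 0) := by
    intro z
    simpa using ((tendsto_pow_atTop_nhds_zero_of_lt_one hρ hβM).const_mul
      (C / (1 - β * M))).mul_const (κ z)
  have hlim' : ∀ z, Tendsto (fun k : ℕ => β * M * (C / (1 - β * M) * (β * M) ^ k) * κ z)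
      atTop (𝓝 0) := by
    intro z
    simpa [mul_assoc] using (hlim z).const_mul (β * M)
  have hconv : ∀ {w : ℕ → ℝ} {a : ℝ} {e : ℕ → ℝ}, Tendsto e atTop (𝓝 0) →
      (∀ k, |w k - a| ≤ e k) → Tendsto w atTop (𝓝 a) := fun he hle =>
    tendsto_iff_dist_tendsto_zero.2 (squeeze_zero (fun _ => dist_nonneg) hle he)
  have hL : ∀ k z, _ := fun k z => hκ.opL_sub_le hM α hβ (s := s) (c := c) (hu k)
    (h' := (ψ, r)) ⟨hψ, hr⟩ (by positivity : 0 ≤ C / (1 - β * M) * (β * M) ^ k) (hψu k) (hru k) z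
  simp only [← hu1] at hL
  refine ⟨(ψ, r), ⟨hψ, hr⟩, Prod.ext (funext fun z => ?_) (funext fun z => ?_)⟩
  · exact tendsto_nhds_unique (hconv (hlim' z) fun k => (hL k z).1)
      ((tendsto_add_atTop_iff_nat 1).2 (hconv (hlim z) fun k => hψu k z))
  · exact tendsto_nhds_unique (hconv (hlim' z) fun k => (hL k z).2)
      ((tendsto_add_atTop_iff_nat 1).2 (hconv (hlim z) fun k => hru k z))

end Weighted

/-! ### The law of the controlled process -/

instance isProbabilityMeasure_pathLaw (P : Kernel Z Z) [IsMarkovKernel P] (α : unitInterval)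
    (σ : Policy Z) (x : Z × Bool) : IsProbabilityMeasure (pathLaw P α σ x) := by
  unfold pathLaw; infer_instance

theorem measurable_historyAt (t : ℕ) :
    Measurable (historyAt t : (ℕ → Z × Bool) → History Z t) :=
  measurable_pi_lambda _ fun _ => measurable_pi_apply _

theorem measurable_payoff {s c : Z → ℝ} (hs : Measurable s) (hc : Measurable c) (σ : Policy Z)
    (t : ℕ) : Measurable (payoff s c σ t) := by
  classical
  exact Measurable.ite (measurable_historyAt t (measurableSet_continues σ t))
    (hc.comp (measurable_pi_apply t).fst) (hs.comp (measurable_pi_apply t).fst)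

theorem IsWeight.integrable_prod {P : Kernel Z Z} {M : ℝ} {κ : Z → ℝ} (hκ : IsWeight P M κ) 
    {f : Z × Bool → ℝ} (hf : Measurable f) {C : ℝ} (hle : ∀ y, |f y| ≤ C * κ y.1) (ν : Measure Bool)
    [IsFiniteMeasure ν] (z : Z) : Integrable f ((P z).prod ν) :=
  (((hκ.integrable z).const_mul C).comp_fst ν).mono' hf.aestronglyMeasurable (ae_of_all _ hle)

section Path

variable (P : Kernel Z Z) [IsMarkovKernel P] (α : unitInterval) (σ : Policy Z) (x : Z × Bool)

/-- The joint law of a history and of the next state. -/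
theorem map_historyAt_compProd_stepKernel (t : ℕ) :
    (pathLaw P α σ x).map (fun ω => (historyAt t ω, ω (t + 1))) =
      (pathLaw P α σ x).map (historyAt t) ⊗ₘ stepKernel P α σ t := by
  have h1 := Kernel.partialTraj_compProd_eq_map_traj (X := fun _ : ℕ => Z × Bool)
    (κ := stepKernel P α σ) (Nat.zero_le t) (x₀ := fun _ => x)
  have h2 := Kernel.traj_map_frestrictLe_apply (X := fun _ : ℕ => Z × Bool)
    (κ := stepKernel P α σ) 0 t (fun _ => x)
  rw [← h2] at h1
  exact h1.symm

theorem map_eval_zero_pathLaw :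
    (pathLaw P α σ x).map (fun ω => ω 0) = Measure.dirac x := by
  have h2 := Kernel.traj_map_frestrictLe_apply (X := fun _ : ℕ => Z × Bool)
    (κ := stepKernel P α σ) 0 0 (fun _ => x)
  rw [Kernel.partialTraj_self, Kernel.id_apply] at h2
  have h3 := congrArg (Measure.map (lastState : History Z 0 → Z × Bool)) h2
  rw [Measure.map_map (measurable_lastState 0) (by fun_prop),
    Measure.map_dirac' (measurable_lastState 0)] at h3
  exact h3

theorem lintegral_eval_succ {G : Z × Bool → ℝ≥0∞} (hG : Measurable G) (t : ℕ) :
    ∫⁻ ω, G (ω (t + 1)) ∂(pathLaw P α σ x) =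
      ∫⁻ ω, ∫⁻ y, G y ∂(stepKernel P α σ t (historyAt t ω)) ∂(pathLaw P α σ x) := by
  have hpair : Measurable fun ω : ℕ → Z × Bool => (historyAt t ω, ω (t + 1)) :=
    (measurable_historyAt t).prodMk (measurable_pi_apply _)
  have h := lintegral_map (μ := pathLaw P α σ x) (hG.comp measurable_snd) hpair
  rw [map_historyAt_compProd_stepKernel, Measure.lintegral_compProd (hG.comp measurable_snd),
    lintegral_map (by exact Measurable.lintegral_kernel hG) (measurable_historyAt t)] at h
  exact h.symm

/-- The tower property: condition on the history at t, then average over the history. -/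
theorem integral_eval_succ {f : Z × Bool → ℝ} (hf : Measurable f) (t : ℕ)
    (hint : Integrable (fun ω => f (ω (t + 1))) (pathLaw P α σ x)) :
    Integrable (fun ω => ∫ y, f y ∂(stepKernel P α σ t (historyAt t ω))) (pathLaw P α σ x) ∧
    ∫ ω, f (ω (t + 1)) ∂(pathLaw P α σ x) =
      ∫ ω, ∫ y, f y ∂(stepKernel P α σ t (historyAt t ω)) ∂(pathLaw P α σ x) := by
  have hpair : Measurable fun ω : ℕ → Z × Bool => (historyAt t ω, ω (t + 1)) :=
    (measurable_historyAt t).prodMk (measurable_pi_apply _)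
  have hf2 : Measurable fun p : History Z t × (Z × Bool) => f p.2 := hf.comp measurable_snd
  have hm : StronglyMeasurable fun h => ∫ y, f y ∂(stepKernel P α σ t h) :=
    hf.stronglyMeasurable.integral_kernel
  have hi : Integrable (fun p : History Z t × (Z × Bool) => f p.2)
      ((pathLaw P α σ x).map (historyAt t) ⊗ₘ stepKernel P α σ t) := by
    rw [← map_historyAt_compProd_stepKernel]
    exact (integrable_map_measure hf2.aestronglyMeasurable hpair.aemeasurable).2 hint
  have h := integral_map (μ := pathLaw P α σ x) hpair.aemeasurable hf2.aestronglyMeasurable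
  rw [map_historyAt_compProd_stepKernel, Measure.integral_compProd hi,
    integral_map (measurable_historyAt t).aemeasurable hm.aestronglyMeasurable] at h
  exact ⟨(integrable_map_measure hm.aestronglyMeasurable
    (measurable_historyAt t).aemeasurable).1 ((Measure.integrable_compProd_iff hf2.aestronglyMeasurable).1 hi |>.2.mono'
    hm.aestronglyMeasurable (ae_of_all _ fun _ => norm_integral_le_integral_norm _)), h.symm⟩

/-- The exogenous component moves by P whatever the policy does, which makes the moment bounds below
uniform over policies. -/
theorem lintegral_fst_stepKernel {G : Z → ℝ≥0∞} (hG : Measurable G) (t : ℕ) (h : History Z t) :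
    ∫⁻ y, G y.1 ∂(stepKernel P α σ t h) = ∫⁻ z, G z ∂(P (lastState h).1) := by
  rw [stepKernel, Kernel.prod_apply, lintegral_prod (fun y => G y.1)
    (hG.comp measurable_fst).aemeasurable]
  simp only [lintegral_const, measure_univ, mul_one, Kernel.comap_apply]

theorem stepKernel_apply_of_mem {t : ℕ} {h : History Z t} (hh : h ∈ continues σ t) :
    stepKernel P α σ t h = (P (lastState h).1).prod (Measure.dirac true) := by
  classical
  rw [stepKernel, Kernel.prod_apply, statusKernel, Kernel.piecewise_apply, if_pos hh]
  rfl

theorem stepKernel_apply_of_notMem {t : ℕ} {h : History Z t} (hh : h ∉ continues σ t) :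
    stepKernel P α σ t h = (P (lastState h).1).prod (bernoulliMeasure true false α) := by
  classical
  rw [stepKernel, Kernel.prod_apply, statusKernel, Kernel.piecewise_apply, if_neg hh]
  rfl

variable {P} {M : ℝ} {κ : Z → ℝ}

/-- The drift inequality for κ, iterated along the path. -/
theorem IsWeight.lintegral_eval_le (hκ : IsWeight P M κ) (hM : 0 ≤ M) (t : ℕ) :
    ∫⁻ ω, ENNReal.ofReal (κ (ω t).1) ∂(pathLaw P α σ x) ≤ ENNReal.ofReal (M ^ t * κ x.1) := by
  have hm : Measurable fun y : Z × Bool => ENNReal.ofReal (κ y.1) :=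
    (hκ.measurable.comp measurable_fst).ennreal_ofReal
  induction t with
  | zero =>
    have h := lintegral_map (μ := pathLaw P α σ x) hm (measurable_pi_apply 0)
    rw [map_eval_zero_pathLaw, lintegral_dirac' _ hm] at h
    simp [← h]
  | succ t ih =>
    rw [lintegral_eval_succ P α σ x hm t]
    simp_rw [lintegral_fst_stepKernel P α σ hκ.measurable.ennreal_ofReal t, lastState_historyAt]
    calc _ ≤ ∫⁻ ω, ENNReal.ofReal M * ENNReal.ofReal (κ (ω t).1) ∂(pathLaw P α σ x) :=
          lintegral_mono fun ω => (hκ.lintegral_le _).trans_eq (ENNReal.ofReal_mul hM)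
      _ = ENNReal.ofReal M * ∫⁻ ω, ENNReal.ofReal (κ (ω t).1) ∂(pathLaw P α σ x) :=
          lintegral_const_mul _ (hm.comp (measurable_pi_apply t))
      _ ≤ ENNReal.ofReal M * ENNReal.ofReal (M ^ t * κ x.1) := by gcongr
      _ = _ := by
          rw [← ENNReal.ofReal_mul hM]
          congr 1
          ring

theorem IsWeight.integrable_eval (hκ : IsWeight P M κ) (hM : 0 ≤ M) (t : ℕ) :
    Integrable (fun ω => κ (ω t).1) (pathLaw P α σ x) := by
  refine ⟨(hκ.measurable.comp (measurable_pi_apply t).fst).aestronglyMeasurable, ?_⟩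
  rw [hasFiniteIntegral_iff_ofReal (ae_of_all _ fun z => (hκ.pos _).le)]
  exact (hκ.lintegral_eval_le α σ x hM t).trans_lt ENNReal.ofReal_lt_top

theorem IsWeight.integral_eval_le (hκ : IsWeight P M κ) (hM : 0 ≤ M) (t : ℕ) :
    ∫ ω, κ (ω t).1 ∂(pathLaw P α σ x) ≤ M ^ t * κ x.1 := by
  rw [integral_eq_lintegral_of_nonneg_ae (ae_of_all _ fun z => (hκ.pos _).le)
    (hκ.measurable.comp (measurable_pi_apply t).fst).aestronglyMeasurable]
  exact ENNReal.toReal_le_of_le_ofReal (mul_nonneg (pow_nonneg hM t) (hκ.pos _).le)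
    (hκ.lintegral_eval_le α σ x hM t)

theorem IsWeight.integrable_of_le_eval (hκ : IsWeight P M κ) (hM : 0 ≤ M) {t : ℕ}
    {F : (ℕ → Z × Bool) → ℝ} (hF : Measurable F) {C : ℝ} (hle : ∀ ω, |F ω| ≤ C * κ (ω t).1) :
    Integrable F (pathLaw P α σ x) :=
  ((hκ.integrable_eval α σ x hM t).const_mul C).mono' hF.aestronglyMeasurable (ae_of_all _ hle)

theorem IsWeight.integral_abs_le (hκ : IsWeight P M κ) (hM : 0 ≤ M) {t : ℕ}
    {F : (ℕ → Z × Bool) → ℝ} (hF : Measurable F) {C : ℝ} (hC : 0 ≤ C)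
    (hle : ∀ ω, |F ω| ≤ C * κ (ω t).1) :
    ∫ ω, |F ω| ∂(pathLaw P α σ x) ≤ C * (M ^ t * κ x.1) := by
  have h1 := integral_mono (hκ.integrable_of_le_eval α σ x hM hF hle).abs
    ((hκ.integrable_eval α σ x hM t).const_mul C) hle
  rw [integral_const_mul] at h1
  exact h1.trans (mul_le_mul_of_nonneg_left (hκ.integral_eval_le α σ x hM t) hC)

theorem IsWeight.integral_stepKernel_of_mem (hκ : IsWeight P M κ) {f : Z × Bool → ℝ}
    (hf : Measurable f) {C : ℝ} (hle : ∀ y, |f y| ≤ C * κ y.1) {t : ℕ} {h : History Z t}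
    (hh : h ∈ continues σ t) :
    ∫ y, f y ∂(stepKernel P α σ t h) = ∫ z, f (z, true) ∂(P (lastState h).1) := by
  rw [stepKernel_apply_of_mem P α σ hh,
    integral_prod_symm _ (hκ.integrable_prod hf hle _ _), integral_dirac]

theorem IsWeight.integral_stepKernel_of_notMem (hκ : IsWeight P M κ) {f : Z × Bool → ℝ}
    (hf : Measurable f) {C : ℝ} (hle : ∀ y, |f y| ≤ C * κ y.1) {t : ℕ} {h : History Z t}
    (hh : h ∉ continues σ t) :
    ∫ y, f y ∂(stepKernel P α σ t h) = α * ∫ z, f (z, true) ∂(P (lastState h).1) +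
      (1 - α) * ∫ z, f (z, false) ∂(P (lastState h).1) := by
  rw [stepKernel_apply_of_notMem P α σ hh,
    integral_prod_symm _ (hκ.integrable_prod hf hle _ _), integral_bernoulliMeasure,
    smul_eq_mul, smul_eq_mul]

theorem abs_payoff_le {s c : Z → ℝ} {K : ℝ} (hsK : ∀ z, |s z| ≤ K * κ z)
    (hcK : ∀ z, |c z| ≤ K * κ z) (t : ℕ) (ω : ℕ → Z × Bool) :
    |payoff s c σ t ω| ≤ K * κ (ω t).1 := by
  unfold payoff
  split_ifs
  · exact hcK _
  · exact hsK _

end Path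

/-! ### Lifetime payoffs -/

/-- Absolute convergence and integrability of a series of integrable functions whose `L¹`-norms are
summable. -/
theorem ae_summable_and_integrable_tsum {Ω : Type*} [MeasurableSpace Ω] {μ : Measure Ω}
    {F : ℕ → Ω → ℝ} (hF : ∀ t, Integrable (F t) μ) (hsum : Summable fun t => ∫ ω, |F t ω| ∂μ) :
    (∀ᵐ ω ∂μ, Summable fun t => F t ω) ∧ Integrable (fun ω => ∑' t, F t ω) μ := by
  have hfin : ∫⁻ ω, ∑' t, ‖F t ω‖ₑ ∂μ < ∞ := by
    rw [lintegral_tsum fun t => (hF t).1.enorm]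
    have : ∀ t, ∫⁻ ω, ‖F t ω‖ₑ ∂μ = ENNReal.ofReal (∫ ω, |F t ω| ∂μ) := fun t =>
      (ofReal_integral_norm_eq_lintegral_enorm (hF t)).symm
    simp_rw [this]
    exact hsum.tsum_ofReal_lt_top
  have hae : ∀ᵐ ω ∂μ, Summable fun t => F t ω := by
    filter_upwards [ae_lt_top' (AEMeasurable.tsum fun t => (hF t).1.enorm) hfin.ne]
      with ω hω
    exact Summable.of_enorm hω.ne
  refine ⟨hae, ?_, ?_⟩
  · refine aestronglyMeasurable_of_tendsto_ae atTop
      (f := fun T ω => ∑ t ∈ Finset.range T, F t ω)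
      (fun T => Finset.aestronglyMeasurable_fun_sum _ fun t _ => (hF t).1) ?_
    filter_upwards [hae] with ω hω
    exact hω.hasSum.tendsto_sum_nat
  · exact (lintegral_mono fun ω => enorm_tsum_le_tsum_enorm).trans_lt hfin

/-! ### Verification: fixed points of `opL` are value functions -/

section Value

variable {P : Kernel Z Z} [IsMarkovKernel P] {M : ℝ} {κ : Z → ℝ} (α : unitInterval) (σ : Policy Z)
  (x : Z × Bool) {β : ℝ} {s c : Z → ℝ} {K : ℝ}

theorem IsWeight.integrable_payoff (hκ : IsWeight P M κ) (hM : 0 ≤ M) (hs : Measurable s)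
    (hc : Measurable c) (hsK : ∀ z, |s z| ≤ K * κ z) (hcK : ∀ z, |c z| ≤ K * κ z) (t : ℕ) :
    Integrable (fun ω => β ^ t * payoff s c σ t ω) (pathLaw P α σ x) :=
  (hκ.integrable_of_le_eval α σ x hM (measurable_payoff hs hc σ t)
    (abs_payoff_le σ hsK hcK t)).const_mul _

/-- The date-t term is at most K κ(x) (βM)^t, a convergent geometric series. -/
theorem IsWeight.summable_integral_abs_payoff (hκ : IsWeight P M κ) (hM : 0 ≤ M) (hβ : 0 ≤ β)
    (hβM : β * M < 1) (hs : Measurable s) (hc : Measurable c) (hK : 0 ≤ K)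
    (hsK : ∀ z, |s z| ≤ K * κ z) (hcK : ∀ z, |c z| ≤ K * κ z) :
    Summable fun t => ∫ ω, |β ^ t * payoff s c σ t ω| ∂(pathLaw P α σ x) := by
  refine Summable.of_nonneg_of_le (fun t => integral_nonneg fun _ => abs_nonneg _) (fun t => ?_)
    ((summable_geometric_of_lt_one (mul_nonneg hβ hM) hβM).mul_left (K * κ x.1))
  simp_rw [abs_mul, abs_of_nonneg (pow_nonneg hβ t)]
  rw [integral_const_mul]
  calc _ ≤ β ^ t * (K * (M ^ t * κ x.1)) := mul_le_mul_of_nonneg_left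
        (hκ.integral_abs_le α σ x hM (measurable_payoff hs hc σ t) hK
          (abs_payoff_le σ hsK hcK t)) (pow_nonneg hβ t)
    _ = _ := by ring

theorem IsWeight.tendsto_policyValue (hκ : IsWeight P M κ) (hM : 0 ≤ M) (hβ : 0 ≤ β)
    (hβM : β * M < 1) (hs : Measurable s) (hc : Measurable c) (hK : 0 ≤ K)
    (hsK : ∀ z, |s z| ≤ K * κ z) (hcK : ∀ z, |c z| ≤ K * κ z) :
    Tendsto (fun T : ℕ => ∑ t ∈ Finset.range T, β ^ t * ∫ ω, payoff s c σ t ω ∂(pathLaw P α σ x))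
      atTop (𝓝 (policyValue P α β s c σ x)) := by
  have h := hasSum_integral_of_summable_integral_norm
    (fun t => hκ.integrable_payoff (β := β) α σ x hM hs hc hsK hcK t)
    (hκ.summable_integral_abs_payoff α σ x hM hβ hβM hs hc hK hsK hcK)
  simp_rw [integral_const_mul] at h
  exact h.tendsto_sum_nat

/-- The value function generated by a pair `(ψ, r)`. -/
noncomputable def statusValue (h : (Z → ℝ) × (Z → ℝ)) (y : Z × Bool) : ℝ :=
  if y.2 = true then max (h.2 y.1) (h.1 y.1) else h.2 y.1

theorem exists_abs_statusValue_le (hpos : ∀ z, 0 < κ z) {h : (Z → ℝ) × (Z → ℝ)}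
    (hh : h ∈ weightedBounded κ ×ˢ weightedBounded κ) :
    ∃ C, 0 ≤ C ∧ ∀ y, |statusValue h y| ≤ C * κ y.1 := by
  obtain ⟨-, A, hA, h1⟩ := (mem_weightedBounded_iff hpos).1
    (max_mem_weightedBounded hpos hh.2 hh.1)
  obtain ⟨-, B, hB, h2⟩ := (mem_weightedBounded_iff hpos).1 hh.2
  refine ⟨max A B, le_max_of_le_left hA, fun y => ?_⟩
  unfold statusValue
  split_ifs
  · exact (h1 _).trans (mul_le_mul_of_nonneg_right (le_max_left _ _) (hpos _).le)
  · exact (h2 _).trans (mul_le_mul_of_nonneg_right (le_max_right _ _) (hpos _).le)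

theorem measurable_statusValue {h : (Z → ℝ) × (Z → ℝ)} (h1 : Measurable h.1)
    (h2 : Measurable h.2) : Measurable (statusValue h) :=
  Measurable.ite (measurable_snd (measurableSet_singleton true))
    ((h2.comp measurable_fst).max (h1.comp measurable_fst)) (h2.comp measurable_fst)

/-- The value of a fixed point of `L` along one step: the payoff plus the discounted expected value
of next period's state is `ψ` if the agent continues and `r` otherwise. -/
theorem IsWeight.payoff_add_step (hκ : IsWeight P M κ) {h : (Z → ℝ) × (Z → ℝ)}
    (hh : h ∈ weightedBounded κ ×ˢ weightedBounded κ) (hfix : opL P α β s c h = h) (t : ℕ)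
    (ω : ℕ → Z × Bool) [Decidable (historyAt t ω ∈ continues σ t)] :
    payoff s c σ t ω + β * ∫ y, statusValue h y ∂(stepKernel P α σ t (historyAt t ω)) =
      if historyAt t ω ∈ continues σ t then h.1 (ω t).1 else h.2 (ω t).1 := by
  obtain ⟨C, -, hC⟩ := exists_abs_statusValue_le hκ.pos hh
  have hm := measurable_statusValue hh.1.1 hh.2.1
  have hf1 : ∀ z, c z + β * ∫ z', max (h.2 z') (h.1 z') ∂(P z) = h.1 z := fun z =>
    congrFun (congrArg Prod.fst hfix) z
  have hf2 : ∀ z, s z + (α : ℝ) * β * ∫ z', max (h.2 z') (h.1 z') ∂(P z)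
      + (1 - (α : ℝ)) * β * ∫ z', h.2 z' ∂(P z) = h.2 z := fun z =>
    congrFun (congrArg Prod.snd hfix) z
  by_cases hmem : historyAt t ω ∈ continues σ t
  · rw [payoff, if_pos hmem, if_pos hmem, hκ.integral_stepKernel_of_mem α σ hm hC hmem, ← hf1]
    rfl
  · rw [payoff, if_neg hmem, if_neg hmem, hκ.integral_stepKernel_of_notMem α σ hm hC hmem, ← hf2]
    simp only [statusValue, lastState_historyAt, if_true, Bool.false_eq_true, if_false]
    ring

/-- Adds and subtracts the discounted next value, in the form needed for telescoping. -/
theorem IsWeight.integral_payoff_eq (hκ : IsWeight P M κ) (hM : 0 ≤ M) (hs : Measurable s)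
    (hc : Measurable c) (hsK : ∀ z, |s z| ≤ K * κ z) (hcK : ∀ z, |c z| ≤ K * κ z)
    {h : (Z → ℝ) × (Z → ℝ)} (hh : h ∈ weightedBounded κ ×ˢ weightedBounded κ) (t : ℕ) :
    Integrable (fun ω => payoff s c σ t ω +
        β * ∫ y, statusValue h y ∂(stepKernel P α σ t (historyAt t ω))) (pathLaw P α σ x) ∧
    ∫ ω, payoff s c σ t ω ∂(pathLaw P α σ x) =
      ∫ ω, (payoff s c σ t ω + β * ∫ y, statusValue h y ∂(stepKernel P α σ t (historyAt t ω)))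
        ∂(pathLaw P α σ x) - β * ∫ ω, statusValue h (ω (t + 1)) ∂(pathLaw P α σ x) := by
  obtain ⟨C, -, hC⟩ := exists_abs_statusValue_le hκ.pos hh
  have hm := measurable_statusValue hh.1.1 hh.2.1
  have hpay := hκ.integrable_of_le_eval α σ x hM (measurable_payoff hs hc σ t)
    (abs_payoff_le σ hsK hcK t)
  obtain ⟨h1, h2⟩ := integral_eval_succ P α σ x hm t
    (hκ.integrable_of_le_eval α σ x hM (hm.comp (measurable_pi_apply (t + 1))) fun ω => hC _)
  refine ⟨hpay.add (h1.const_mul β), ?_⟩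
  rw [integral_add hpay (h1.const_mul β), integral_const_mul, h2]
  ring

theorem integral_eval_zero {f : Z × Bool → ℝ} (hf : Measurable f) :
    ∫ ω, f (ω 0) ∂(pathLaw P α σ x) = f x := by
  have h := integral_map (μ := pathLaw P α σ x) (measurable_pi_apply 0).aemeasurable
    hf.aestronglyMeasurable
  rw [map_eval_zero_pathLaw, integral_dirac' _ _ hf.stronglyMeasurable] at h
  exact h.symm

/-- The transversality condition: the growth M^T of E[κ(Z_T)] is beaten by β^T since βM < 1. -/
theorem IsWeight.tendsto_discounted_statusValue (hκ : IsWeight P M κ) (hM : 0 ≤ M) (hβ : 0 ≤ β)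
    (hβM : β * M < 1) {h : (Z → ℝ) × (Z → ℝ)}
    (hh : h ∈ weightedBounded κ ×ˢ weightedBounded κ) :
    Tendsto (fun T : ℕ => β ^ T * ∫ ω, statusValue h (ω T) ∂(pathLaw P α σ x)) atTop (𝓝 0) := by
  obtain ⟨C, hC0, hC⟩ := exists_abs_statusValue_le hκ.pos hh
  have hm := measurable_statusValue hh.1.1 hh.2.1
  have hlim : Tendsto (fun T : ℕ => C * κ x.1 * (β * M) ^ T) atTop (𝓝 0) := by
    simpa using (tendsto_pow_atTop_nhds_zero_of_lt_one (mul_nonneg hβ hM) hβM).const_mul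
      (C * κ x.1)
  refine squeeze_zero_norm (fun T => ?_) hlim
  rw [norm_mul, Real.norm_of_nonneg (pow_nonneg hβ T)]
  calc _ ≤ β ^ T * (C * (M ^ T * κ x.1)) := mul_le_mul_of_nonneg_left
        ((norm_integral_le_integral_norm _).trans (hκ.integral_abs_le α σ x hM
          (hm.comp (measurable_pi_apply T)) hC0 fun ω => hC _)) (pow_nonneg hβ T)
    _ = _ := by ring

/-- The discounted sum of the drifts of the value process is the value of the policy minus the
initial value. -/
theorem IsWeight.tendsto_sum_step (hκ : IsWeight P M κ) (hM : 0 ≤ M) (hβ : 0 ≤ β)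
    (hβM : β * M < 1) (hs : Measurable s) (hc : Measurable c) (hK : 0 ≤ K)
    (hsK : ∀ z, |s z| ≤ K * κ z) (hcK : ∀ z, |c z| ≤ K * κ z) {h : (Z → ℝ) × (Z → ℝ)}
    (hh : h ∈ weightedBounded κ ×ˢ weightedBounded κ) :
    Tendsto (fun T : ℕ => ∑ t ∈ Finset.range T, β ^ t *
        (∫ ω, (payoff s c σ t ω + β * ∫ y, statusValue h y ∂(stepKernel P α σ t (historyAt t ω)))
          ∂(pathLaw P α σ x) - ∫ ω, statusValue h (ω t) ∂(pathLaw P α σ x)))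
      atTop (𝓝 (policyValue P α β s c σ x - statusValue h x)) := by
  have hm := measurable_statusValue hh.1.1 hh.2.1
  have h1 := hκ.tendsto_policyValue α σ x hM hβ hβM hs hc hK hsK hcK
  have h2 := hκ.tendsto_discounted_statusValue α σ x hM hβ hβM hh
  have h3 := (h1.add h2).sub_const (statusValue h x)
  rw [add_zero] at h3
  -- For each T this is an exact identity: the drifts before T sum to the expected payoffs before T
  -- plus β^T E[W(X_T)] minus W(x), where W is `statusValue h`.
  refine h3.congr fun T => ?_
  induction T with
  | zero => simp [integral_eval_zero α σ x hm]
  | succ T ih =>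
    rw [Finset.sum_range_succ _ T, Finset.sum_range_succ _ T, ← ih,
      (hκ.integral_payoff_eq (β := β) α σ x hM hs hc hsK hcK hh T).2]
    ring

/-- Every drift is nonpositive: the action taken earns ψ or r, and W is the best of those available
in the current status. -/
theorem IsWeight.policyValue_le (hκ : IsWeight P M κ) (hM : 0 ≤ M) (hβ : 0 ≤ β)
    (hβM : β * M < 1) (hs : Measurable s) (hc : Measurable c) (hK : 0 ≤ K)
    (hsK : ∀ z, |s z| ≤ K * κ z) (hcK : ∀ z, |c z| ≤ K * κ z) {h : (Z → ℝ) × (Z → ℝ)}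
    (hh : h ∈ weightedBounded κ ×ˢ weightedBounded κ) (hfix : opL P α β s c h = h) :
    policyValue P α β s c σ x ≤ statusValue h x := by
  classical
  obtain ⟨C, -, hC⟩ := exists_abs_statusValue_le hκ.pos hh
  have hm := measurable_statusValue hh.1.1 hh.2.1
  refine sub_nonpos.1 (le_of_tendsto'
    (hκ.tendsto_sum_step α σ x hM hβ hβM hs hc hK hsK hcK hh) fun T => ?_)
  refine Finset.sum_nonpos fun t _ =>
    mul_nonpos_of_nonneg_of_nonpos (pow_nonneg hβ t) (sub_nonpos.2 ?_)
  refine integral_mono (hκ.integral_payoff_eq (β := β) α σ x hM hs hc hsK hcK hh t).1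
    (hκ.integrable_of_le_eval α σ x hM (hm.comp (measurable_pi_apply t)) fun ω => hC _)
    fun ω => ?_
  simp only
  rw [hκ.payoff_add_step α σ hh hfix t ω]
  unfold statusValue
  split_ifs with h1 h2
  · exact le_max_right _ _
  -- Continuing requires the active status, so this case is void.
  · exact absurd h1.1 h2
  · exact le_max_left _ _
  · exact le_rfl

/-- The stationary policy that exits if and only if `ψ ≤ r` at the current state. -/
noncomputable def thresholdPolicy {h : (Z → ℝ) × (Z → ℝ)} (h1 : Measurable h.1) (h2 : Measurable h.2) :
    Policy Z where
  exit t y := decide (h.1 (lastState y).1 ≤ h.2 (lastState y).1)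
  measurable_exit t := by
    have hl := (measurable_lastState (Z := Z) t).fst
    exact measurable_to_bool (by
      simpa [preimage] using measurableSet_le (h1.comp hl) (h2.comp hl))

/-- Every drift vanishes: when active the rule selects the larger of ψ and r, and when passive both
sides are r. -/
theorem IsWeight.policyValue_thresholdPolicy (hκ : IsWeight P M κ) (hM : 0 ≤ M) (hβ : 0 ≤ β)
    (hβM : β * M < 1) (hs : Measurable s) (hc : Measurable c) (hK : 0 ≤ K)
    (hsK : ∀ z, |s z| ≤ K * κ z) (hcK : ∀ z, |c z| ≤ K * κ z) {h : (Z → ℝ) × (Z → ℝ)}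
    (hh : h ∈ weightedBounded κ ×ˢ weightedBounded κ) (hfix : opL P α β s c h = h) :
    policyValue P α β s c (thresholdPolicy hh.1.1 hh.2.1) x = statusValue h x := by
  classical
  refine sub_eq_zero.1 (tendsto_nhds_unique
    (hκ.tendsto_sum_step α _ x hM hβ hβM hs hc hK hsK hcK hh) ?_)
  refine tendsto_const_nhds.congr fun T => (Finset.sum_eq_zero fun t _ => ?_).symm
  rw [mul_eq_zero, sub_eq_zero]
  right
  refine integral_congr_ae (ae_of_all _ fun ω => ?_)
  simp only
  rw [hκ.payoff_add_step α _ hh hfix t ω]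
  unfold statusValue
  simp only [continues, thresholdPolicy, lastState_historyAt, mem_ofPred_eq, decide_eq_false_iff_not,
    not_le]
  by_cases hst : (ω t).2 = true
  · simp only [hst, true_and, if_true]
    split_ifs with hlt
    · exact (max_eq_right hlt.le).symm
    · exact (max_eq_left (not_lt.1 hlt)).symm
  · simp [hst]

/-- Attainment gives at once that the set of policy values is bounded above and what its real
supremum is. -/
theorem IsWeight.isGreatest_statusValue (hκ : IsWeight P M κ) (hM : 0 ≤ M) (hβ : 0 ≤ β)
    (hβM : β * M < 1) (hs : Measurable s) (hc : Measurable c) (hK : 0 ≤ K)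
    (hsK : ∀ z, |s z| ≤ K * κ z) (hcK : ∀ z, |c z| ≤ K * κ z) {h : (Z → ℝ) × (Z → ℝ)}
    (hh : h ∈ weightedBounded κ ×ˢ weightedBounded κ) (hfix : opL P α β s c h = h) :
    IsGreatest (range fun σ : Policy Z => policyValue P α β s c σ x) (statusValue h x) := by
  refine ⟨⟨_, hκ.policyValue_thresholdPolicy α x hM hβ hβM hs hc hK hsK hcK hh hfix⟩, ?_⟩
  rintro _ ⟨σ, rfl⟩
  exact hκ.policyValue_le α σ x hM hβ hβM hs hc hK hsK hcK hh hfix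

/-- Once r ∨ ψ is known to be v*, the first fixed point equation becomes the definition of ψ*. -/
theorem IsWeight.value_eq_of_fixedPoint (hκ : IsWeight P M κ) (hM : 0 ≤ M) (hβ : 0 ≤ β)
    (hβM : β * M < 1) (hs : Measurable s) (hc : Measurable c) (hK : 0 ≤ K)
    (hsK : ∀ z, |s z| ≤ K * κ z) (hcK : ∀ z, |c z| ≤ K * κ z) {h : (Z → ℝ) × (Z → ℝ)}
    (hh : h ∈ weightedBounded κ ×ˢ weightedBounded κ) (hfix : opL P α β s c h = h) :
    activeValue P α β s c = (fun z => max (h.2 z) (h.1 z)) ∧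
      h = (continuationValue P α β s c, passiveValue P α β s c) := by
  have hV := fun x => (hκ.isGreatest_statusValue α x hM hβ hβM hs hc hK hsK hcK hh hfix).csSup_eq
  have hact : activeValue P α β s c = fun z => max (h.2 z) (h.1 z) := funext fun z => hV (z, true)
  refine ⟨hact, Prod.ext ?_ (funext fun z => (hV (z, false)).symm)⟩
  refine (congrArg Prod.fst hfix).symm.trans ?_
  funext z
  simp only [opL, continuationValue, hact]

end Value

end RepeatedDecision

theorem mainTheorem2 {Z : Type*} [MeasurableSpace Z]
    -- the stochastic kernel, the return probability, the discount factor and the payoffs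
    (P : Kernel Z Z) [IsMarkovKernel P] (α : unitInterval) (β : ℝ) (hβ : β ∈ Ioo (0 : ℝ) 1)
    (s c : Z → ℝ) (hs : Measurable s) (hc : Measurable c)
    -- the drift assumption
    (g : Z → ℝ) (n : ℕ) (m d : ℝ) (hdrift : RepeatedDecision.DriftAssumption P β s c g n m d)
    -- the expectations that enter the weight function are finite
    (hfin : ∀ t < n, ∀ z, Integrable s ((P ^ t) z) ∧ Integrable c ((P ^ t) z))
    -- the constants of the weight function
    (m' d' : ℝ) (hm' : 0 < m') (hd' : 0 < d') (h1 : 1 < m + 2 * m') (h2 : β * (m + 2 * m') < 1)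
    (h3 : d / (m + 2 * m' - 1) ≤ d')
    (κ : Z → ℝ) (hκ : κ = RepeatedDecision.weight P s c g n m' d') :
    -- the quantities involved are well defined
    ((∀ (σ : RepeatedDecision.Policy Z) (x : Z × Bool),
        (∀ᵐ ω ∂(RepeatedDecision.pathLaw P α σ x),
          Summable fun t : ℕ => β ^ t * RepeatedDecision.payoff s c σ t ω) ∧
        Integrable (RepeatedDecision.lifetimePayoff β s c σ) (RepeatedDecision.pathLaw P α σ x)) ∧
      (∀ x : Z × Bool, BddAbove
        (range fun σ : RepeatedDecision.Policy Z =>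
          RepeatedDecision.policyValue P α β s c σ x)) ∧
      (∀ z, Integrable (RepeatedDecision.activeValue P α β s c) (P z)) ∧
      (∀ f ∈ RepeatedDecision.weightedBounded κ, ∀ z, Integrable f (P z))) ∧
    -- `L` is a contraction mapping of modulus `β (m + 2 m')`
    RepeatedDecision.IsContractionOn (RepeatedDecision.weightedDist κ)
      (RepeatedDecision.opL P α β s c)
      (RepeatedDecision.weightedBounded κ ×ˢ RepeatedDecision.weightedBounded κ)
      (β * (m + 2 * m')) ∧
    -- `(ψ*, r*)` is the unique fixed point of `L`
    (∀ h : (Z → ℝ) × (Z → ℝ),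
      (h ∈ RepeatedDecision.weightedBounded κ ×ˢ RepeatedDecision.weightedBounded κ ∧
        RepeatedDecision.opL P α β s c h = h) ↔
      h = (RepeatedDecision.continuationValue P α β s c,
        RepeatedDecision.passiveValue P α β s c)) := by
  subst hκ
  have hw := RepeatedDecision.isWeight_weight hs hc hdrift hfin hm' hd' h1 h3
  have hM : 0 ≤ m + 2 * m' := by linarith
  have hβ0 : 0 ≤ β := hβ.1.le
  have hK0 : (0 : ℝ) ≤ max 1 (1 / m') := le_max_of_le_left zero_le_one
  have hK := RepeatedDecision.abs_le_mul_weight hs hc hdrift hm' hd'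
  have hsK := fun z => (hK z).1
  have hcK := fun z => (hK z).2
  have hsB := (RepeatedDecision.mem_weightedBounded_iff hw.pos).2 ⟨hs, _, hK0, hsK⟩
  have hcB := (RepeatedDecision.mem_weightedBounded_iff hw.pos).2 ⟨hc, _, hK0, hcK⟩
  obtain ⟨h, hh, hfix⟩ := hw.exists_fixedPoint hM α hβ0 h2 hsB hcB
  obtain ⟨hact, hval⟩ := hw.value_eq_of_fixedPoint α hM hβ0 h2 hs hc hK0 hsK hcK hh hfix
  refine ⟨⟨fun σ x => ?_, fun x => ?_, fun z => ?_, fun f hf z => hw.integrable_of_mem hf z⟩,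
    hw.isContractionOn_opL hM α hβ0 h2 hsB hcB, fun h' => ⟨fun hh' => ?_, ?_⟩⟩
  · exact RepeatedDecision.ae_summable_and_integrable_tsum
      (fun t => hw.integrable_payoff α σ x hM hs hc hsK hcK t)
      (hw.summable_integral_abs_payoff α σ x hM hβ0 h2 hs hc hK0 hsK hcK)
  · exact (hw.isGreatest_statusValue α x hM hβ0 h2 hs hc hK0 hsK hcK hh hfix).bddAbove
  · rw [hact]
    exact hw.integrable_of_mem (RepeatedDecision.max_mem_weightedBounded hw.pos hh.2 hh.1) z
  -- Uniqueness: verification applies to the arbitrary fixed point `h'`, so the contraction estimate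
  -- is not needed again.
  · exact (hw.value_eq_of_fixedPoint α hM hβ0 h2 hs hc hK0 hsK hcK hh'.1 hh'.2).2
  · rintro rfl
    rw [← hval]
    exact ⟨hh, hfix⟩
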